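/- Let $S$ be a countably infinite discrete semigroup. Let $\beta S$ be its Stone–Čech compactification, realized as the space of ultrafilters on $S$ with basic open sets $\{p : A\in p\}$ $(A\subseteq S)$ and with the semigroup operation given by $A\in p\cdot q \iff \{s\in S : \{t\in S : st\in A\}\in q\}\in p$. Let $S^*\subseteq\beta S$ be the subspace of free ultrafilters (those all of whose members are infinite). Suppose that $S$ is weakly cancellative, i.e. for all $s,t\in S$ the sets $\{x\in S : sx=t\}$ and $\{x\in S: xs=t\}$ are finite. A left ideal of $S^*$ is a nonempty $L\subseteq S^*$ with $S^*\cdot L\subseteq L$; it is minimal if it properly contains no other left ideal of $S^*$. A set $X\subseteq S^*$ is a weak $P$-set if $\overline{D}\cap X=\emptyset$ for every countable $D\subseteq S^*\setminus X$. Then: 1. There is a minimal left ideal $L$ of $S^*$ that is a weak $P$-set in $S^*$. If $S$ is also left-cancellative, then every $L$ as in (1) has the following properties: 2. $L$ is prime in $S^*$: for all $p\in\beta S$ and $q\in S^*$, $p\cdot q\in L$ if and only if $q\in L$. 3. $L$ contains idempotents, and every idempotent $p\in L$ is left-maximal in $S^*$: if $q\in S^*$ is idempotent and $p\le_L q$,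 then $q\le_L p$. In particular $p$ is both minimal and maximal among the idempotents of $S^*$: it is maximal with respect to $\le$, and minimal with respect to each of $\le_L$, $\le_R$ and $\le$. Here, for idempotents $p,q$, $p\le_L q$ means $p\cdot q=p$, $p\le_R q$ means $q\cdot p=p$, and $p\le q$ means that both hold; maximality and minimality with respect to these preorders are meant in the sense of preorders ($p$ is maximal if $p\le q$ implies $q\le p$, and minimal if $q\le p$ implies $p\le q$). -/

import Mathlib

/- The product on `Ultrafilter S` is Mathlib's: `A ∈ p * q` if and only if
`{s | {t | s * t ∈ A} ∈ q} ∈ p`. The topology on `Ultrafilter S` is Mathlib's as well; its basic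
open sets are `{p | A ∈ p}`, so `Ultrafilter S` is the Stone-Čech compactification of the
discrete space `S`. -/
attribute [local instance] Ultrafilter.mul Ultrafilter.semigroup

namespace UltraIdeal

/-- All the translations `x ↦ s * x` and `x ↦ x * s` are finite-to-one. -/
def WeaklyCancellative (S : Type*) [Mul S] : Prop :=
  ∀ s t : S, {x : S | s * x = t}.Finite ∧ {x : S | x * s = t}.Finite

/-- The set `S*` of free ultrafilters on `S`: every member is infinite. -/
def freeUltrafilters (S : Type*) : Set (Ultrafilter S) :=
  {p | ∀ A ∈ p, A.Infinite}

/-- `X` is a weak `P`-set in the space `Y`: the closure of every countable subset of the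
complement of `X` misses `X`. -/
def IsWeakPSet {Y : Type*} [TopologicalSpace Y] (X : Set Y) : Prop :=
  ∀ D : Set Y, D ⊆ Xᶜ → D.Countable → closure D ∩ X = ∅

section Semigroup

variable {M : Type*} [Mul M]

/-- `L` is a left ideal of the subsemigroup `T`. -/
def IsLeftIdealIn (T L : Set M) : Prop :=
  L.Nonempty ∧ L ⊆ T ∧ ∀ p ∈ T, ∀ q ∈ L, p * q ∈ L

/-- `L` is a left ideal of `T` that does not properly contain another left ideal of `T`. -/
def IsMinimalLeftIdealIn (T L : Set M) : Prop :=
  IsLeftIdealIn T L ∧ ∀ L' : Set M, IsLeftIdealIn T L' → L' ⊆ L → L' = L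

/-- The relation `p ≤_L q` (a preorder on idempotents). -/
def LeL (p q : M) : Prop := p * q = p

/-- The relation `p ≤_R q` (a preorder on idempotents). -/
def LeR (p q : M) : Prop := q * p = p

/-- The relation `p ≤ q` (a partial order on idempotents). -/
def LeLR (p q : M) : Prop := LeL p q ∧ LeR p q

/-- `p` is an idempotent of `T` that is maximal for the preorder `r` among the idempotents
of `T`. -/
def IsMaximalIdempotentIn (r : M → M → Prop) (T : Set M) (p : M) : Prop :=
  p ∈ T ∧ IsIdempotentElem p ∧ ∀ q ∈ T, IsIdempotentElem q → r p q → r q p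

/-- `p` is an idempotent of `T` that is minimal for the preorder `r` among the idempotents
of `T`. -/
def IsMinimalIdempotentIn (r : M → M → Prop) (T : Set M) (p : M) : Prop :=
  p ∈ T ∧ IsIdempotentElem p ∧ ∀ q ∈ T, IsIdempotentElem q → r q p → r p q

end Semigroup

end UltraIdeal

/-! A proper left-invariant filter `F ≤ cofinite` cuts out a closed left ideal of `S*`, which is
minimal when `F` has no proper invariant refinement. The weak `P`-set property comes from Kunen's OK
property: given `U n ∈ F`, there are uncountably many `V α ∈ F` such that any intersection of more
than `n` of them is almost contained in `U n`. Free ultrafilters `d n` omitting `U n` then contain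
finitely many `V α` each, so a single `V α` separates all of them from the ideal
(`isWeakPSet_of_settles`).

`F` is built by a recursion of length continuum. Independent linked rows are carried to `S` by
sparse right translates whose index is eventually unchanged by left translation, so invariance and
independence coexist. Each sequence `U` costs finitely many rows: it either receives its witnesses
or is excluded for good (`IsGood.exists_settles`).

With left cancellation, `q ∉ L` implies `pure s * q ∉ L` for all `s`; as `p * q` is in the closure
of these countably many points, `L` is prime. Hence idempotents `≤_L`-above one in `L` lie in `L`,
where every idempotent is a right identity. -/

namespace UltraIdeal

open Filter Set
open scoped Cardinal

/-! ### Transfinite recursion -/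

/-- Transfinite exhaustion: if every task can be done at the cost of finitely many indices, then all
of at most `#I` tasks can be done. -/
theorem exists_exhaustive_filter.{u, v} {α : Type u} {I : Type v} (hI : ℵ₀ < #I)
    (Good : Filter α → Set I → Prop) (Done : I → Filter α → Prop) (F₀ : Filter α)
    (h₀ : Good F₀ ∅)
    (hdone : ∀ t F F', F' ≤ F → Done t F → Done t F')
    (hsup : ∀ (ι : Type v) [Nonempty ι] (F : ι → Filter α) (J : ι → Set I),
      (∀ i j, ∃ k, F k ≤ F i ∧ F k ≤ F j ∧ J i ⊆ J k ∧ J j ⊆ J k) → (∀ i, Good (F i) (J i)) →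
      Good (⨅ i, F i) (⋃ i, J i))
    (hstep : ∀ t F J, Good F J → #J < #I →
      ∃ F' K, K.Finite ∧ F' ≤ F ∧ Good F' (J ∪ K) ∧ Done t F') :
    ∃ F J, Good F J ∧ ∀ t, Done t F := by
  have hstep' : ∀ t F J, ∃ F' K, K.Finite ∧ F' ≤ F ∧
      (Good F J → #J < #I → Good F' (J ∪ K) ∧ Done t F') := by
    intro t F J
    by_cases h : Good F J ∧ #J < #I
    · obtain ⟨F', K, hK, hF, hG⟩ := hstep t F J h.1 h.2
      exact ⟨F', K, hK, hF, fun _ _ => hG⟩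
    · exact ⟨F, ∅, Set.finite_empty, le_rfl, fun h1 h2 => absurd ⟨h1, h2⟩ h⟩
  choose Φ κ hκ hΦ hgood using hstep'
  -- A well-order of minimal type: proper initial segments are smaller than `I`, so finite costs
  -- never exhaust the indices.
  obtain ⟨r, wo, hr⟩ := Cardinal.exists_ord_eq I
  have hwf : WellFounded r := wo.wf
  let G : I → Filter α × Set I := hwf.fix fun t ih =>
    (Φ t (F₀ ⊓ ⨅ u, ⨅ h : r u t, (ih u h).1) (⋃ u, ⋃ h : r u t, (ih u h).2),
      κ t (F₀ ⊓ ⨅ u, ⨅ h : r u t, (ih u h).1) (⋃ u, ⋃ h : r u t, (ih u h).2))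
  let pF : Set I → Filter α := fun D => F₀ ⊓ ⨅ u ∈ D, (G u).1
  let pJ : Set I → Set I := fun D => ⋃ u ∈ D, (G u).2
  let below : I → Set I := fun t => {u | r u t}
  have hG : ∀ t, G t = (Φ t (pF (below t)) (pJ (below t)), κ t (pF (below t)) (pJ (below t))) :=
    fun t => hwf.fix_eq _ t
  have hGle : ∀ t, (G t).1 ≤ pF (below t) := fun t => by rw [hG]; exact hΦ _ _ _
  have hfin : ∀ t, (G t).2.Finite := fun t => by rw [hG]; exact hκ _ _ _
  have hcard : ∀ t, #(pJ (below t)) < #I := by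
    intro t
    refine (Cardinal.mk_biUnion_le _ _).trans_lt (Cardinal.mul_lt_of_lt hI.le ?_ ?_)
    · exact Cardinal.card_typein_lt (r := r) t hr
    · refine lt_of_le_of_lt (ciSup_le' fun u => ?_) hI
      exact ((hfin u).lt_aleph0).le
  have hjoin : ∀ D : Set I, (∀ t ∈ D, below t ⊆ D) → (∀ t ∈ D, Good (pF (below t)) (pJ (below t))) →
      Good (pF D) (pJ D) := by
    intro D hD hgd
    rcases D.eq_empty_or_nonempty with rfl | hne
    · simpa [pF, pJ] using h₀
    have : Nonempty D := hne.to_subtype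
    have e1 : pF D = ⨅ t : D, (G t).1 := by
      have : ⨅ t : D, (G t).1 = ⨅ u ∈ D, (G u).1 := iInf_subtype
      simp only [pF, this]
      refine inf_eq_right.2 ?_
      obtain ⟨t, ht⟩ := hne
      exact (iInf₂_le t ht).trans ((hGle t).trans inf_le_left)
    have e2 : pJ D = ⋃ t : D, (pJ (below t) ∪ (G t).2) := by
      apply Set.Subset.antisymm
      · refine Set.iUnion₂_subset fun t ht => ?_
        exact Set.subset_iUnion_of_subset ⟨t, ht⟩ Set.subset_union_right
      · refine Set.iUnion_subset fun t => Set.union_subset ?_ ?_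
        · exact Set.biUnion_subset_biUnion_left (hD t t.2)
        · exact Set.subset_biUnion_of_mem (u := fun u => (G u).2) t.2
    rw [e1, e2]
    refine hsup D (fun t => (G t).1) _ ?_ ?_
    · have key : ∀ i j : I, r i j → (G j).1 ≤ (G i).1 ∧
          pJ (below i) ∪ (G i).2 ⊆ pJ (below j) ∪ (G j).2 := by
        intro i j hij
        refine ⟨(hGle j).trans (inf_le_right.trans (iInf₂_le i hij)), ?_⟩
        refine (Set.union_subset ?_ ?_).trans Set.subset_union_left
        · exact Set.biUnion_subset_biUnion_left fun u hu => _root_.trans hu hij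
        · exact Set.subset_biUnion_of_mem (u := fun u => (G u).2) hij
      intro i j
      rcases trichotomous_of r i.1 j.1 with h | h | h
      · exact ⟨j, (key _ _ h).1, le_rfl, (key _ _ h).2, subset_rfl⟩
      · have : i = j := Subtype.ext h
        subst this
        exact ⟨i, le_rfl, le_rfl, subset_rfl, subset_rfl⟩
      · exact ⟨i, le_rfl, (key _ _ h).1, subset_rfl, (key _ _ h).2⟩
    · intro t
      have := (hgood t (pF (below t)) (pJ (below t)) (hgd t t.2) (hcard t)).1
      simpa only [hG t.1] using this
  have hall : ∀ t, Good (pF (below t)) (pJ (below t)) := by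
    intro t
    induction t using hwf.induction with
    | _ t ih => exact hjoin _ (fun u hu v hv => _root_.trans hv hu) fun u hu => ih u hu
  refine ⟨pF Set.univ, pJ Set.univ, hjoin _ (fun _ _ => Set.subset_univ _) fun t _ => hall t, ?_⟩
  intro t
  refine hdone t (G t).1 _ (inf_le_right.trans (iInf₂_le t (Set.mem_univ t))) ?_
  rw [hG]
  exact (hgood t _ _ (hall t) (hcard t)).2

/-! ### An independent matrix of linked families -/

/-- The countable set that carries an independent matrix of linked families. -/
abbrev MatrixPoint : Type := Σ k : ℕ, (Finset (Fin k) → Finset (Finset (Fin k)))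

open Classical in
/-- The trace of a set of natural numbers on `{0, …, k - 1}`. -/
noncomputable def traceBelow (k : ℕ) (R : Set ℕ) : Finset (Fin k) :=
  Finset.univ.filter fun i => (i : ℕ) ∈ R

/-- The cells of the independent matrix. -/
def cell (K : Set (Set ℕ)) (q : Set ℕ → Finset (Set ℕ)) : Set MatrixPoint :=
  {ν | ∀ R ∈ K, ν.2 (traceBelow ν.1 R) = (q R).image (traceBelow ν.1)}

/-- The entries of the linked matrix. -/
def linkedEntry (R α : Set ℕ) (n : ℕ) : Set MatrixPoint :=
  {ν | (ν.2 (traceBelow ν.1 R)).card ≤ n ∧ traceBelow ν.1 α ∈ ν.2 (traceBelow ν.1 R)}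

theorem eventually_traceBelow_ne {R R' : Set ℕ} (h : R ≠ R') :
    ∀ᶠ k in atTop, traceBelow k R ≠ traceBelow k R' := by
  obtain ⟨m, hm⟩ : ∃ m, ¬ (m ∈ R ↔ m ∈ R') := by
    by_contra! hh
    exact h (Set.ext hh)
  filter_upwards [eventually_gt_atTop m] with k hk he
  have := Finset.ext_iff.1 he ⟨m, hk⟩
  simp [traceBelow] at this
  exact hm this

theorem eventually_injOn_traceBelow {K : Set (Set ℕ)} (hK : K.Finite) :
    ∀ᶠ k in atTop, InjOn (traceBelow k) K := by
  have : ∀ᶠ k in atTop, ∀ R ∈ K, ∀ R' ∈ K, R ≠ R' → traceBelow k R ≠ traceBelow k R' := by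
    rw [eventually_all_finite hK]
    intro R _
    rw [eventually_all_finite hK]
    intro R' _
    by_cases h : R = R'
    · simp [h]
    · filter_upwards [eventually_traceBelow_ne h] with k hk _ using hk
  filter_upwards [this] with k hk R hR R' hR' he
  by_contra hne
  exact hk R hR R' hR' hne he

theorem cell_infinite {K : Set (Set ℕ)} (hK : K.Finite) (q : Set ℕ → Finset (Set ℕ)) :
    (cell K q).Infinite := by
  intro hfin
  have hfin' := hfin.image Sigma.fst
  obtain ⟨k, hk, hk'⟩ := ((eventually_injOn_traceBelow hK).and
    (Nat.cofinite_eq_atTop ▸ hfin'.eventually_cofinite_notMem)).exists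
  -- Traces at level `k` distinguish the rows in `K`, so their values can be prescribed
  -- independently.
  refine hk' ⟨⟨k, fun x => (q (Function.invFunOn (traceBelow k) K x)).image (traceBelow k)⟩, ?_, rfl⟩
  intro R hR
  simp only
  rw [hk.leftInvOn_invFunOn hR]

theorem cell_anti {K K' : Set (Set ℕ)} (h : K ⊆ K') (q : Set ℕ → Finset (Set ℕ)) :
    cell K' q ⊆ cell K q := fun _ hν R hR => hν R (h hR)

theorem cell_congr {K : Set (Set ℕ)} {q q' : Set ℕ → Finset (Set ℕ)} (h : ∀ R ∈ K, q R = q' R) :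
    cell K q = cell K q' := by
  ext ν
  exact forall₂_congr fun R hR => by rw [h R hR]

theorem cell_subset_linkedEntry {K : Set (Set ℕ)} {q : Set ℕ → Finset (Set ℕ)} {R α : Set ℕ}
    {n : ℕ} (hR : R ∈ K) (hα : α ∈ q R) (hn : (q R).card ≤ n) : cell K q ⊆ linkedEntry R α n := by
  intro ν hν
  refine ⟨?_, ?_⟩
  · rw [hν R hR]
    exact Finset.card_image_le.trans hn
  · rw [hν R hR]
    exact Finset.mem_image_of_mem _ hα

theorem linkedEntry_mono (R α : Set ℕ) : Monotone (linkedEntry R α) :=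
  fun _ _ h _ hν => ⟨hν.1.trans h, hν.2⟩

/-- At all but finitely many levels the members of `c` have distinct traces, too many for a value of
size at most `n`; each level is finite. -/
theorem finite_iInter_linkedEntry (R : Set ℕ) {c : Finset (Set ℕ)} {n : ℕ} (hn : n < c.card) :
    (⋂ α ∈ c, linkedEntry R α n).Finite := by
  have h1 : {k | ¬ InjOn (traceBelow k) (c : Set (Set ℕ))}.Finite := by
    have := eventually_injOn_traceBelow c.finite_toSet
    rwa [← Nat.cofinite_eq_atTop] at this
  refine (h1.biUnion fun k _ => finite_range (Sigma.mk k)).subset ?_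
  intro ν hν
  simp only [mem_iInter] at hν
  refine mem_biUnion (x := ν.1) (fun hinj => ?_) ⟨ν.2, rfl⟩
  obtain ⟨α, hα⟩ : c.Nonempty := Finset.card_pos.1 (by omega)
  have : (c.image (traceBelow ν.1)).card ≤ n :=
    (Finset.card_le_card (Finset.image_subset_iff.2 fun β hβ => (hν β hβ).2)).trans (hν α hα).1
  rw [Finset.card_image_of_injOn hinj] at this
  omega

instance : Infinite MatrixPoint :=
  Infinite.of_injective (fun k : ℕ => (⟨k, fun _ => ∅⟩ : MatrixPoint)) fun a b h => by
    simpa using congrArg Sigma.fst h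

/-! ### Transport of the matrix to `S` -/

theorem WeaklyCancellative.tendsto_mul_left {S : Type*} [Mul S]
    (hS : WeaklyCancellative S) (s : S) : Tendsto (s * ·) cofinite cofinite :=
  Tendsto.cofinite_of_finite_preimage_singleton fun t => (hS s t).1

/-- A sparse sequence of right translates, with a finite-to-one map reading off the index. -/
theorem exists_sparse_translates {S : Type*} [Semigroup S] [Countable S] [Infinite S]
    (hS : WeaklyCancellative S) (N : Type*) [Countable N] [Infinite N] :
    ∃ (σ : N → S) (π : S → N), (∀ ν, (π ⁻¹' {ν}).Finite) ∧
      ∀ y, ∀ᶠ ν in cofinite, π (y * σ ν) = ν := by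
  classical
  obtain ⟨e⟩ := nonempty_equiv_of_countable (α := ℕ) (β := S)
  obtain ⟨d⟩ := nonempty_equiv_of_countable (α := ℕ) (β := N)
  let B : ℕ × S → Set S := fun x => (fun i => e i * x.2) '' Iio x.1
  have hB : ∀ x, (B x).Finite := fun x => (finite_Iio x.1).image _
  obtain ⟨f, -, hf⟩ := exists_seq_of_forall_finset_exists (fun _ : ℕ × S => True)
    (fun x y => x.1 < y.1 ∧ Disjoint (B x) (B y)) (by
      intro s _
      obtain ⟨n, hn⟩ := (s.image Prod.fst).exists_nat_subset_range
      have hfin : (⋃ i ∈ Iio n, ⋃ t ∈ ⋃ x ∈ s, B x, {x : S | e i * x = t}).Finite :=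
        (finite_Iio n).biUnion fun i _ =>
          (s.finite_toSet.biUnion fun x _ => hB x).biUnion fun t _ => (hS _ _).1
      obtain ⟨a, ha⟩ := hfin.exists_notMem
      refine ⟨(n, a), trivial, fun x hx => ⟨?_, ?_⟩⟩
      · simpa using hn (Finset.mem_image_of_mem Prod.fst hx)
      · rw [Set.disjoint_left]
        rintro z hz ⟨i, hi, rfl⟩
        refine ha (mem_biUnion hi (mem_biUnion (mem_biUnion hx hz) rfl)))
  have hmono : StrictMono fun n => (f n).1 := fun m n h => (hf m n h).1
  have hdisj : ∀ m n z, z ∈ B (f m) → z ∈ B (f n) → m = n := by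
    intro m n z hm hn
    rcases lt_trichotomy m n with h | h | h
    · exact absurd hn (Set.disjoint_left.1 (hf m n h).2 hm)
    · exact h
    · exact absurd hm (Set.disjoint_left.1 (hf n m h).2 hn)
  -- Off the blocks, the injective default `e.symm z` keeps the fibres finite.
  let π : S → ℕ := fun z => if h : ∃ n, z ∈ B (f n) then h.choose else e.symm z
  have hπ : ∀ n z, z ∈ B (f n) → π z = n := by
    intro n z hz
    have h : ∃ n, z ∈ B (f n) := ⟨n, hz⟩
    simp only [π, dif_pos h]
    exact hdisj _ _ z h.choose_spec hz
  refine ⟨fun ν => (f (d.symm ν)).2, fun z => d (π z), fun ν => ?_, fun y => ?_⟩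
  · refine ((hB (f (d.symm ν))).union (finite_singleton (e (d.symm ν)))).subset ?_
    intro z hz
    have hz' : π z = d.symm ν := by
      rw [← (show d (π z) = ν from hz), Equiv.symm_apply_apply]
    rw [← hz']
    by_cases h : ∃ n, z ∈ B (f n)
    · left
      simp only [π, dif_pos h]
      exact h.choose_spec
    · right
      simp [π, dif_neg h]
  · have : ∀ᶠ n in cofinite, π (y * (f n).2) = n := by
      rw [Nat.cofinite_eq_atTop]
      filter_upwards [eventually_gt_atTop (e.symm y)] with n hn
      exact hπ n _ ⟨e.symm y, hn.trans_le hmono.le_apply, by simp⟩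
    filter_upwards [d.symm.injective.tendsto_cofinite.eventually this] with ν hν
    simp [hν]

/-- The filter generated by the tails of all sequences `y * σ ν`. -/
def translateFilter {S N : Type*} [Mul S] (σ : N → S) : Filter S :=
  ⨆ y, map (fun ν => y * σ ν) cofinite

/-- A filter that is preserved by all left translations. -/
def IsInvariantFilter {S : Type*} [Mul S] (F : Filter S) : Prop :=
  ∀ s, Tendsto (s * ·) F F

/-- An invariant filter modulo which the rows outside `J` are independent. -/
structure IsGood {S : Type*} [Mul S] (σ : MatrixPoint → S) (π : S → MatrixPoint)
    (F : Filter S) (J : Set (Set ℕ)) : Prop where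
  le : F ≤ translateFilter σ
  invariant : IsInvariantFilter F
  neBot : ∀ K : Set (Set ℕ), K.Finite → Disjoint K J → ∀ q, (F ⊓ 𝓟 (π ⁻¹' cell K q)).NeBot

/-- Either `F` contains all `U n` and uncountably many sets that witness the `OK` property for `U`,
or no proper invariant filter finer than `F` contains all `U n`. -/
def Settles {S : Type*} [Mul S] (U : ℕ → Set S) (F : Filter S) : Prop :=
  ((∀ n, U n ∈ F) ∧ ∃ V : Set ℕ → Set S, (∀ α, V α ∈ F) ∧
    ∀ (c : Finset (Set ℕ)) (n : ℕ), n < c.card → ((⋂ α ∈ c, V α) \ U n).Finite) ∨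
  ∀ F' ≤ F, IsInvariantFilter F' → (∀ n, U n ∈ F') → F' = ⊥

/-- A function that tends to infinity along `F` and whose superlevel sets lie in the sets `U n`. -/
theorem exists_rank {S : Type*} [Countable S] {F : Filter S} (hF : F ≤ cofinite) {U : ℕ → Set S}
    (hU : ∀ n, U n ∈ F) :
    ∃ h : S → ℕ, Tendsto h F atTop ∧ ∀ z n, n < h z → z ∈ U n := by
  classical
  obtain ⟨e, he⟩ := exists_injective_nat S
  -- The bound `e z` makes the maximum exist, yet tends to infinity along `F`.
  refine ⟨fun z => Nat.findGreatest (fun m => ∀ i < m, z ∈ U i) (e z), ?_, fun z n hn => ?_⟩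
  · refine tendsto_atTop.2 fun n => ?_
    have h1 : ∀ᶠ z in F, n ≤ e z :=
      hF (he.tendsto_cofinite.eventually (Nat.cofinite_eq_atTop ▸ eventually_ge_atTop n))
    have h2 : ∀ᶠ z in F, ∀ i < n, z ∈ U i :=
      (eventually_all_finite (finite_Iio n)).2 fun i _ => hU i
    filter_upwards [h1, h2] with z hz hz'
    exact Nat.le_findGreatest hz hz'
  · exact Nat.findGreatest_spec (P := fun m => ∀ i < m, z ∈ U i) (Nat.zero_le (e z))
      (by simp) n hn

/-! ### Invariant filters and the recursion step -/

section
variable {S : Type*} [Semigroup S]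

theorem Settles.mono {U : ℕ → Set S} {F F' : Filter S} (h : F' ≤ F) (hF : Settles U F) :
    Settles U F' := by
  rcases hF with ⟨hU, V, hV, hc⟩ | hF
  · exact Or.inl ⟨fun n => h (hU n), V, fun α => h (hV α), hc⟩
  · exact Or.inr fun F'' h' => hF F'' (h'.trans h)

theorem IsInvariantFilter.inf {F G : Filter S} (hF : IsInvariantFilter F)
    (hG : IsInvariantFilter G) : IsInvariantFilter (F ⊓ G) := fun s => (hF s).inf (hG s)

theorem IsInvariantFilter.iInf {ι : Sort*} {F : ι → Filter S}
    (hF : ∀ i, IsInvariantFilter (F i)) : IsInvariantFilter (⨅ i, F i) :=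
  fun s => tendsto_iInf_iInf fun i => hF i s

/-- The coarsest invariant filter finer than `G`. -/
def invariantHull (G : Filter S) : Filter S := G ⊓ ⨅ s : S, comap (s * ·) G

theorem invariantHull_le (G : Filter S) : invariantHull G ≤ G := inf_le_left

theorem isInvariantFilter_invariantHull (G : Filter S) :
    IsInvariantFilter (invariantHull G) := by
  intro s
  refine tendsto_inf.2 ⟨?_, tendsto_iInf.2 fun t => tendsto_comap_iff.2 ?_⟩
  · exact tendsto_iff_comap.2 (inf_le_right.trans (iInf_le _ s))
  · have : ((t * ·) ∘ (s * ·) : S → S) = (t * s * ·) := by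
      ext x; simp [mul_assoc]
    rw [this]
    exact tendsto_iff_comap.2 (inf_le_right.trans (iInf_le _ (t * s)))

theorem IsInvariantFilter.le_invariantHull {F G : Filter S} (hF : IsInvariantFilter F)
    (h : F ≤ G) : F ≤ invariantHull G :=
  le_inf h (le_iInf fun s => tendsto_iff_comap.1 ((hF s).mono_right h))

variable {σ : MatrixPoint → S} {π : S → MatrixPoint}

theorem mem_translateFilter {A : Set S} :
    A ∈ translateFilter σ ↔ ∀ y, ∀ᶠ ν in cofinite, y * σ ν ∈ A := by
  simp only [translateFilter, mem_iSup]
  rfl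

theorem isInvariantFilter_translateFilter : IsInvariantFilter (translateFilter σ) := by
  intro s A hA
  rw [mem_translateFilter] at hA
  rw [mem_map, mem_translateFilter]
  intro y
  simpa [mul_assoc] using hA (s * y)

variable (hπ : ∀ y, ∀ᶠ ν in cofinite, π (y * σ ν) = ν)
include hπ

theorem translateFilter_le_cofinite : translateFilter σ ≤ cofinite := by
  refine iSup_le fun y A hA => ?_
  have h : ((Aᶜ).image π).Finite := (mem_cofinite.1 hA).image π
  change ∀ᶠ ν in cofinite, y * σ ν ∈ A
  filter_upwards [hπ y, h.eventually_cofinite_notMem] with ν hν hν'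
  by_contra hc
  exact hν' ⟨_, hc, hν⟩

/-- This makes adding a cell `π ⁻¹' cell K q` compatible with invariance. -/
theorem eventually_translateFilter_index_eq (s : S) :
    ∀ᶠ z in translateFilter σ, π (s * z) = π z := by
  refine mem_translateFilter.2 fun y => ?_
  filter_upwards [hπ y, hπ (s * y)] with ν h1 h2
  rw [← mul_assoc, h1, h2]

theorem isGood_translateFilter : IsGood σ π (translateFilter σ) ∅ where
  le := le_rfl
  invariant := isInvariantFilter_translateFilter
  neBot := by
    intro K hK _ q
    rw [inf_principal_neBot_iff]
    intro A hA
    let y := σ (Classical.arbitrary _)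
    obtain ⟨ν, hν, h1, h2⟩ := ((frequently_cofinite_iff_infinite.2 (cell_infinite hK q)).and_eventually
      ((mem_translateFilter.1 hA y).and (hπ y))).exists
    exact ⟨_, h1, by rwa [mem_preimage, h2]⟩

omit hπ in
theorem IsGood.iInf {ι : Type*} [Nonempty ι] {F : ι → Filter S} {J : ι → Set (Set ℕ)}
    (hdir : Directed (· ≥ ·) F) (h : ∀ i, IsGood σ π (F i) (J i)) :
    IsGood σ π (⨅ i, F i) (⋃ i, J i) where
  le := (iInf_le F (Classical.arbitrary ι)).trans (h _).le
  invariant := IsInvariantFilter.iInf fun i => (h i).invariant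
  neBot := by
    intro K hK hKJ q
    rw [disjoint_iUnion_right] at hKJ
    rw [iInf_inf]
    have hd : Directed (· ≥ ·) fun i => F i ⊓ 𝓟 (π ⁻¹' cell K q) := fun i j =>
      let ⟨k, hi, hj⟩ := hdir i j
      ⟨k, inf_le_inf_right _ hi, inf_le_inf_right _ hj⟩
    exact iInf_neBot_of_directed' hd fun i => (h i).neBot K hK (hKJ i) q

theorem IsGood.inf_cell {F : Filter S} {J K : Set (Set ℕ)} (h : IsGood σ π F J) (hK : K.Finite)
    (hKJ : Disjoint K J) (q : Set ℕ → Finset (Set ℕ)) :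
    IsGood σ π (F ⊓ 𝓟 (π ⁻¹' cell K q)) (J ∪ K) where
  le := inf_le_left.trans h.le
  invariant := by
    intro s
    refine tendsto_inf.2 ⟨(h.invariant s).mono_left inf_le_left, tendsto_principal.2 ?_⟩
    filter_upwards [mem_inf_of_left (h.le (eventually_translateFilter_index_eq hπ s)),
      mem_inf_of_right (mem_principal_self _)] with z h1 h2
    rw [mem_preimage, h1]
    exact h2
  neBot := by
    classical
    intro K' hK' hd q'
    rw [disjoint_union_right] at hd
    refine (h.neBot (K ∪ K') (hK.union hK') (disjoint_union_left.2 ⟨hKJ, hd.1⟩)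
      (fun R => if R ∈ K then q R else q' R)).mono ?_
    rw [inf_assoc, inf_principal]
    refine inf_le_inf_left _ (principal_mono.2 (subset_inter ?_ ?_))
    · refine preimage_mono ((cell_anti subset_union_left _).trans (cell_congr fun R hR => ?_).le)
      simp [hR]
    · refine preimage_mono ((cell_anti subset_union_right _).trans (cell_congr fun R hR => ?_).le)
      simp [Set.disjoint_left.1 hd.2 hR]

theorem IsGood.exists_ok [Countable S] (hfin : ∀ ν, (π ⁻¹' {ν}).Finite) {F : Filter S}
    {J : Set (Set ℕ)} (hF : IsGood σ π F J) {R : Set ℕ} (hR : R ∉ J) {U : ℕ → Set S}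
    (hU : ∀ n, U n ∈ F) :
    ∃ F' ≤ F, IsGood σ π F' (J ∪ {R}) ∧ Settles U F' := by
  classical
  obtain ⟨h, hh, hhU⟩ := exists_rank (hF.le.trans (translateFilter_le_cofinite hπ)) hU
  -- The linkedness level grows with the rank `h`, so one set `V α` serves all `n` at once.
  let V : Set ℕ → Set S := fun α => {z | π z ∈ linkedEntry R α (h z)}
  let H : Set ℕ → Filter S := fun α => invariantHull (𝓟 (V α))
  refine ⟨F ⊓ ⨅ c : Finset (Set ℕ), ⨅ α ∈ c, H α, inf_le_left, ⟨inf_le_left.trans hF.le,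
    hF.invariant.inf (.iInf fun c => .iInf fun α => .iInf fun _ =>
      isInvariantFilter_invariantHull _), ?_⟩, Or.inl ⟨fun n => mem_inf_of_left (hU n), V, ?_, ?_⟩⟩
  · intro K hK hd q
    rw [disjoint_union_right, disjoint_singleton_right] at hd
    rw [inf_right_comm, inf_iInf]
    refine iInf_neBot_of_directed' ?_ fun c => ?_
    · intro c c'
      refine ⟨c ∪ c', inf_le_inf_left _ ?_, inf_le_inf_left _ ?_⟩
      · exact biInf_mono fun α hα => Finset.mem_union_left _ hα
      · exact biInf_mono fun α hα => Finset.mem_union_right _ hα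
    -- The unused row `R` is given the value `c`: on that cell all entries for `α ∈ c` hold once `h
    -- z ≥ c.card`.
    · let q' := Function.update q R c
      refine (hF.neBot (insert R K) (hK.insert R)
        (disjoint_insert_left.2 ⟨hR, hd.1⟩) q').mono (le_inf (le_inf inf_le_left ?_) ?_)
      · refine inf_le_right.trans (principal_mono.2 (preimage_mono ?_))
        refine (cell_anti (subset_insert R K) _).trans (cell_congr fun R' hR' => ?_).le
        exact Function.update_of_ne (ne_of_mem_of_not_mem hR' hd.2) _ _
      · have hcell : ∀ α ∈ c, ∀ n, c.card ≤ n → cell (insert R K) q' ⊆ linkedEntry R α n :=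
          fun α hα n hn => cell_subset_linkedEntry (mem_insert R K) (by simpa [q'] using hα)
            (by simpa [q'] using hn)
        refine le_iInf₂ fun α hα => le_inf (le_principal_iff.2 ?_) (le_iInf fun s => ?_)
        · filter_upwards [mem_inf_of_left (hh.eventually_ge_atTop c.card),
            mem_inf_of_right (mem_principal_self _)] with z h1 h2
          exact hcell α hα _ h1 h2
        · rw [comap_principal, le_principal_iff]
          -- The translate `s * z` has the same index and, by invariance of `F`, still has large
          -- rank.
          filter_upwards [mem_inf_of_left
              ((hh.comp (hF.invariant s)).eventually_ge_atTop c.card),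
            mem_inf_of_left (hF.le (eventually_translateFilter_index_eq hπ s)),
            mem_inf_of_right (mem_principal_self _)] with z h1 h2 h3
          refine hcell α hα _ h1 ?_
          rw [h2]
          exact h3
  · intro α
    refine mem_inf_of_right (mem_iInf_of_mem {α} ?_)
    simpa [H] using invariantHull_le (𝓟 (V α)) (mem_principal_self _)
  · intro c n hn
    refine ((finite_iInter_linkedEntry R hn).preimage' fun ν _ => hfin ν).subset ?_
    rintro z ⟨hz, hzU⟩
    have hle : h z ≤ n := not_lt.1 fun hlt => hzU (hhU z n hlt)
    simp only [mem_iInter, mem_preimage] at hz ⊢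
    exact fun α hα => linkedEntry_mono R α hle (hz α hα)

theorem IsGood.exists_settles [Countable S] (hfin : ∀ ν, (π ⁻¹' {ν}).Finite) {F : Filter S}
    {J : Set (Set ℕ)} (hF : IsGood σ π F J) (hJ : J ≠ univ) (U : ℕ → Set S) :
    ∃ F' K, K.Finite ∧ F' ≤ F ∧ IsGood σ π F' (J ∪ K) ∧ Settles U F' := by
  -- If this filter is good, a fresh row supplies OK witnesses; otherwise some cell is incompatible
  -- with it, and adding that cell to `F` excludes `U` permanently.
  let F₁ := F ⊓ invariantHull (⨅ n, 𝓟 (U n))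
  have hF₁ : F₁ ≤ F := inf_le_left
  by_cases hgood : IsGood σ π F₁ J
  · obtain ⟨R, hR⟩ := (ne_univ_iff_exists_notMem J).1 hJ
    obtain ⟨F', h1, h2, h3⟩ := hgood.exists_ok hπ hfin hR (U := U) fun n =>
      mem_inf_of_right (invariantHull_le _ (mem_iInf_of_mem n (mem_principal_self _)))
    exact ⟨F', {R}, finite_singleton R, h1.trans hF₁, h2, h3⟩
  · obtain ⟨K, hK, hKJ, q, hq⟩ : ∃ K : Set (Set ℕ), K.Finite ∧ Disjoint K J ∧
        ∃ q, F₁ ⊓ 𝓟 (π ⁻¹' cell K q) = ⊥ := by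
      by_contra! hc
      exact hgood ⟨hF₁.trans hF.le, hF.invariant.inf (isInvariantFilter_invariantHull _),
        hc⟩
    refine ⟨_, K, hK, inf_le_left, hF.inf_cell hπ hK hKJ q, Or.inr fun F' hF' hinv hU => ?_⟩
    rw [eq_bot_iff, ← hq]
    refine le_inf (le_inf (hF'.trans inf_le_left) (hinv.le_invariantHull ?_))
      (hF'.trans inf_le_right)
    exact le_iInf fun n => le_principal_iff.2 (hU n)

end

/-- There is a proper invariant filter of cofinite type that settles every sequence of sets. -/
theorem exists_settling_filter {S : Type*} [Semigroup S] [Countable S] [Infinite S]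
    (hS : WeaklyCancellative S) :
    ∃ F : Filter S, F.NeBot ∧ F ≤ cofinite ∧ IsInvariantFilter F ∧ ∀ U, Settles U F := by
  obtain ⟨σ, π, hfin, hπ⟩ := exists_sparse_translates hS MatrixPoint
  obtain ⟨e⟩ := nonempty_equiv_of_countable (α := ℕ) (β := S)
  -- Sequences of subsets of `S` are coded by subsets of `ℕ`, so there are as many tasks as rows.
  let τ : Set ℕ → ℕ → Set S := fun t n => {z | Nat.pair n (e.symm z) ∈ t}
  have hτ : ∀ U, ∃ t, τ t = U := fun U =>
    ⟨{m | e m.unpair.2 ∈ U m.unpair.1}, by ext; simp [τ]⟩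
  obtain ⟨F, J, hF, hset⟩ := exists_exhaustive_filter (I := Set ℕ) (by simpa using Cardinal.aleph0_lt_continuum)
    (IsGood σ π) (fun t => Settles (τ t)) (translateFilter σ) (isGood_translateFilter hπ)
    (fun t F F' h hF => hF.mono h)
    (fun ι _ F J hd h => IsGood.iInf
      (fun i j => let ⟨k, h1, h2, _⟩ := hd i j; ⟨k, h1, h2⟩) h)
    (fun t F J hF hJ => hF.exists_settles hπ hfin (by
      rintro rfl
      simp at hJ) _)
  refine ⟨F, ?_, hF.le.trans (translateFilter_le_cofinite hπ), hF.invariant, fun U => ?_⟩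
  · exact (hF.neBot ∅ finite_empty (empty_disjoint _) fun _ => ∅).mono inf_le_left
  · obtain ⟨t, rfl⟩ := hτ U
    exact hset t

/-! ### From invariant filters to ideals of `S*` -/

theorem mem_freeUltrafilters_iff {S : Type*} {p : Ultrafilter S} :
    p ∈ freeUltrafilters S ↔ (p : Filter S) ≤ cofinite := by
  refine ⟨fun h A hA => ?_, fun h A hA hfin => ?_⟩
  · by_contra hc
    exact h _ (Ultrafilter.compl_mem_iff_notMem.2 hc) (mem_cofinite.1 hA)
  · exact Ultrafilter.compl_notMem_iff.2 hA (h hfin.compl_mem_cofinite)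

theorem isClosed_freeUltrafilters (S : Type*) : IsClosed (freeUltrafilters S) := by
  have : freeUltrafilters S = ⋂ A : {A : Set S // A.Finite}, {p | A.1ᶜ ∈ p} := by
    ext p
    simp only [mem_iInter, mem_ofPred_eq, Subtype.forall, Ultrafilter.compl_mem_iff_notMem]
    exact ⟨fun h A hA hp => h A hp hA, fun h A hp hA => h A hA hp⟩
  rw [this]
  exact isClosed_iInter fun A => ultrafilter_isClosed_basic _

section
variable {S : Type*} [Semigroup S]

theorem mem_mul_iff {p q : Ultrafilter S} {A : Set S} :
    A ∈ p * q ↔ {s | (s * ·) ⁻¹' A ∈ q} ∈ p := Iff.rfl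

theorem mem_pure_mul_iff {s : S} {q : Ultrafilter S} {A : Set S} :
    A ∈ pure s * q ↔ (s * ·) ⁻¹' A ∈ q := Iff.rfl

theorem mul_mem_freeUltrafilters (hS : WeaklyCancellative S) (p : Ultrafilter S)
    {q : Ultrafilter S} (hq : q ∈ freeUltrafilters S) : p * q ∈ freeUltrafilters S := by
  intro A hA hfin
  obtain ⟨s, hs⟩ := p.nonempty_of_mem (mem_mul_iff.1 hA)
  exact hq _ hs (hfin.preimage' fun t _ => (hS s t).1)

theorem freeUltrafilters_nonempty (S : Type*) [Infinite S] : (freeUltrafilters S).Nonempty :=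
  ⟨hyperfilter S, mem_freeUltrafilters_iff.2 hyperfilter_le_cofinite⟩

/-- The left ideal `S* * q`. -/
theorem isLeftIdealIn_image_mul [Infinite S] (hS : WeaklyCancellative S) {q : Ultrafilter S}
    (hq : q ∈ freeUltrafilters S) :
    IsLeftIdealIn (freeUltrafilters S) ((· * q) '' freeUltrafilters S) := by
  refine ⟨(freeUltrafilters_nonempty S).image _, ?_, ?_⟩
  · rintro _ ⟨p, -, rfl⟩
    exact mul_mem_freeUltrafilters hS p hq
  · rintro p - _ ⟨r, hr, rfl⟩
    exact ⟨p * r, mul_mem_freeUltrafilters hS p hr, mul_assoc _ _ _⟩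

/-- The invariant filter corresponding to the closed left ideal `S* * q`. -/
def orbitFilter (q : Ultrafilter S) : Filter S :=
  cofinite.bind fun s => map (s * ·) (q : Filter S)

theorem mem_orbitFilter {q : Ultrafilter S} {A : Set S} :
    A ∈ orbitFilter q ↔ ∀ᶠ s in cofinite, (s * ·) ⁻¹' A ∈ q := Iff.rfl

instance [Infinite S] (q : Ultrafilter S) : (orbitFilter q).NeBot := by
  refine ⟨fun h => ?_⟩
  have : ∅ ∈ orbitFilter q := h ▸ mem_bot
  obtain ⟨s, hs⟩ := (mem_orbitFilter.1 this).exists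
  exact q.empty_notMem hs

theorem isInvariantFilter_orbitFilter (hS : WeaklyCancellative S) (q : Ultrafilter S) :
    IsInvariantFilter (orbitFilter q) := by
  intro t A hA
  have : ((t * ·) ⁻¹' A) ∈ orbitFilter q := by
    rw [mem_orbitFilter]
    filter_upwards [(hS.tendsto_mul_left t).eventually (mem_orbitFilter.1 hA)] with s hs
    simpa [preimage_preimage, mul_assoc] using hs
  exact this

theorem orbitFilter_le {F : Filter S} (hF : IsInvariantFilter F) {q : Ultrafilter S}
    (hq : (q : Filter S) ≤ F) : orbitFilter q ≤ F := fun _ hA =>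
  mem_orbitFilter.2 (Eventually.of_forall fun s => hq (hF s hA))

/-- The sets `g A` for `A ∈ p` must all belong to `r`; they generate a filter compatible with
`cofinite`, since a finite `g A` would put `Aᶜ` in `orbitFilter q`. -/
theorem exists_mul_eq_of_le_orbitFilter {p q : Ultrafilter S}
    (h : (p : Filter S) ≤ orbitFilter q) : ∃ r ∈ freeUltrafilters S, r * q = p := by
  let g : Set S → Set S := fun A => {s | (s * ·) ⁻¹' A ∈ q}
  have hg : Monotone g := fun A B hAB s hs => mem_of_superset hs (preimage_mono hAB)
  have hne : ((p : Filter S).lift' g ⊓ cofinite).NeBot := by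
    rw [inf_neBot_iff_frequently_left]
    intro P hP
    obtain ⟨A, hA, hAP⟩ := (mem_lift'_sets hg).1 hP
    refine frequently_cofinite_iff_infinite.2 fun hfin => ?_
    have : Aᶜ ∈ orbitFilter q := by
      rw [mem_orbitFilter]
      filter_upwards [(hfin.subset hAP).eventually_cofinite_notMem] with s hs
      exact Ultrafilter.compl_mem_iff_notMem.2 hs
    exact Ultrafilter.compl_notMem_iff.2 hA (h this)
  let r := Ultrafilter.of ((p : Filter S).lift' g ⊓ cofinite)
  have hr : (r : Filter S) ≤ (p : Filter S).lift' g ⊓ cofinite := Ultrafilter.of_le _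
  refine ⟨r, mem_freeUltrafilters_iff.2 (hr.trans inf_le_right), ?_⟩
  refine Ultrafilter.coe_le_coe.1 fun A hA => ?_
  exact mem_mul_iff.2 (hr (mem_inf_of_left (mem_lift' hA)))

/-- The ultrafilters finer than a maximal invariant filter form a minimal left ideal. -/
theorem isMinimalLeftIdealIn_of_maximal [Infinite S] (hS : WeaklyCancellative S) {F : Filter S}
    [F.NeBot] (hF : F ≤ cofinite) (hinv : IsInvariantFilter F)
    (hmax : ∀ F' ≤ F, F'.NeBot → IsInvariantFilter F' → F' = F) :
    IsMinimalLeftIdealIn (freeUltrafilters S) {p : Ultrafilter S | (p : Filter S) ≤ F} := by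
  refine ⟨⟨⟨Ultrafilter.of F, Ultrafilter.of_le F⟩,
    fun p hp => mem_freeUltrafilters_iff.2 (hp.trans hF), fun p _ q hq A hA => ?_⟩,
    fun L hL hLF => hLF.antisymm fun p hp => ?_⟩
  · exact mem_mul_iff.2 (univ_mem' fun s => hq (hinv s hA))
  · obtain ⟨q, hq⟩ := hL.1
    have := hmax _ (orbitFilter_le hinv (hLF hq)) inferInstance
      (isInvariantFilter_orbitFilter hS q)
    obtain ⟨r, hr, rfl⟩ := exists_mul_eq_of_le_orbitFilter (p := p) (q := q) (this ▸ hp)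
    exact hL.2.2 r hr q hq

theorem Settles.exists_witness {U : ℕ → Set S} {F : Filter S} [F.NeBot]
    (hF : IsInvariantFilter F) (hU : ∀ n, U n ∈ F) (h : Settles U F) :
    ∃ V : Set ℕ → Set S, (∀ α, V α ∈ F) ∧
      ∀ (c : Finset (Set ℕ)) (n : ℕ), n < c.card → ((⋂ α ∈ c, V α) \ U n).Finite := by
  rcases h with ⟨-, hV⟩ | h
  · exact hV
  · exact absurd (h F le_rfl hF hU) (NeBot.ne ‹_›)

/-- Constant sequences suffice: a set `A` in a proper invariant refinement cannot have been
excluded, so it is already in `F`. -/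
theorem eq_of_settles {F F' : Filter S} (h : ∀ U, Settles U F) (hF' : F' ≤ F) (hne : F'.NeBot)
    (hinv : IsInvariantFilter F') : F' = F := by
  refine hF'.antisymm fun A hA => ?_
  rcases h fun _ => A with ⟨hU, -⟩ | hbot
  · exact hU 0
  · exact absurd (hbot F' hF' hinv fun _ => hA) hne.ne

theorem isWeakPSet_of_settles {F : Filter S} [F.NeBot] (hinv : IsInvariantFilter F)
    (h : ∀ U, Settles U F) :
    IsWeakPSet {x : freeUltrafilters S | (x : Ultrafilter S) ∈
      {p : Ultrafilter S | (p : Filter S) ≤ F}} := by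
  intro D hD hcount
  rcases D.eq_empty_or_nonempty with rfl | hne
  · simp
  obtain ⟨d, rfl⟩ := hcount.exists_eq_range hne
  have hd : ∀ n, ∃ W ∈ F, W ∉ (d n : Ultrafilter S) := by
    intro n
    have := hD (mem_range_self n)
    simpa [Filter.le_def] using this
  choose U hUF hU using hd
  obtain ⟨V, hVF, hV⟩ := (h U).exists_witness hinv hUF
  -- If `d n` contained `n + 1` of the `V α`, it would contain a finite set.
  have hfin : ∀ n, {α | V α ∈ (d n : Ultrafilter S)}.Finite := by
    intro n
    by_contra hinf
    obtain ⟨c, hc, hcard⟩ := Set.Infinite.exists_subset_card_eq hinf (n + 1)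
    have h1 : (⋂ α ∈ c, V α) ∈ (d n : Ultrafilter S) :=
      (biInter_finset_mem c).2 fun α hα => hc hα
    have h2 : (⋂ α ∈ c, V α) \ U n ∈ (d n : Ultrafilter S) :=
      inter_mem h1 (Ultrafilter.compl_mem_iff_notMem.2 (hU n))
    exact (d n).2 _ h2 (hV c n (by omega))
  obtain ⟨α, hα⟩ : ∃ α, α ∉ ⋃ n, {α | V α ∈ (d n : Ultrafilter S)} := by
    refine (ne_univ_iff_exists_notMem _).1 fun he => ?_
    have := he ▸ countable_iUnion fun n => (hfin n).countable
    rw [countable_univ_iff, ← Cardinal.mk_le_aleph0_iff, Cardinal.mk_set, Cardinal.mk_nat] at this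
    exact this.not_gt (Cardinal.cantor _)
  rw [mem_iUnion, not_exists] at hα
  rw [← disjoint_iff_inter_eq_empty, Set.disjoint_left]
  intro x hx hxF
  obtain ⟨_, hy, n, rfl⟩ := mem_closure_iff.1 hx
    ((fun p : freeUltrafilters S => (p : Ultrafilter S)) ⁻¹' {p : Ultrafilter S | V α ∈ p})
    ((ultrafilter_isOpen_basic (V α)).preimage continuous_subtype_val) (hxF (hVF α))
  exact hα n hy

/-! ### Algebra of minimal left ideals -/

variable {L : Set (Ultrafilter S)} [Infinite S] (hS : WeaklyCancellative S)
  (hL : IsMinimalLeftIdealIn (freeUltrafilters S) L)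
include hS hL

theorem IsMinimalLeftIdealIn.image_mul_eq {q : Ultrafilter S} (hq : q ∈ L) :
    (· * q) '' freeUltrafilters S = L := by
  refine hL.2 _ (isLeftIdealIn_image_mul hS (hL.1.2.1 hq)) ?_
  rintro _ ⟨p, hp, rfl⟩
  exact hL.1.2.2 p hp q hq

theorem IsMinimalLeftIdealIn.mul_mem (p : Ultrafilter S) {q : Ultrafilter S} (hq : q ∈ L) :
    p * q ∈ L := by
  obtain ⟨r, hr, hrq⟩ := (hL.image_mul_eq hS hq).symm ▸ hq
  have := hL.1.2.2 (p * r) (mul_mem_freeUltrafilters hS p hr) q hq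
  rwa [mul_assoc, show r * q = q from hrq] at this

theorem IsMinimalLeftIdealIn.exists_isIdempotentElem : ∃ p ∈ L, IsIdempotentElem p := by
  obtain ⟨q, hq⟩ := hL.1.1
  refine exists_idempotent_in_compact_subsemigroup Ultrafilter.continuous_mul_left L hL.1.1 ?_
    fun x hx y hy => hL.1.2.2 x (hL.1.2.1 hx) y hy
  rw [← hL.image_mul_eq hS hq]
  exact (isClosed_freeUltrafilters S).isCompact.image (Ultrafilter.continuous_mul_left q)

theorem IsMinimalLeftIdealIn.mul_eq_self {p x : Ultrafilter S} (hp : p ∈ L)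
    (hpi : IsIdempotentElem p) (hx : x ∈ L) : x * p = x := by
  obtain ⟨r, -, rfl⟩ := (hL.image_mul_eq hS hp).symm ▸ hx
  exact (mul_assoc r p p).trans (congrArg (r * ·) hpi)

/-- An idempotent `f ∈ L` fixes `pure s * q` on the right; cancelling `s` gives `q * f = q`, which
is in `L`. -/
theorem IsMinimalLeftIdealIn.mem_of_pure_mul_mem [IsLeftCancelMul S] {s : S} {q : Ultrafilter S}
    (h : pure s * q ∈ L) : q ∈ L := by
  obtain ⟨f, hf, hfi⟩ := hL.exists_isIdempotentElem hS
  have h1 : pure s * (q * f) = pure s * q := by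
    rw [← mul_assoc, hL.mul_eq_self hS hf hfi h]
  have h2 : q * f = q := by
    refine Ultrafilter.coe_le_coe.1 fun A hA => ?_
    have hpre : (s * ·) ⁻¹' ((s * ·) '' A) = A := preimage_image_eq A (mul_right_injective s)
    have : (s * ·) '' A ∈ pure s * q := by
      rw [mem_pure_mul_iff, hpre]
      exact hA
    rw [← h1, mem_pure_mul_iff, hpre] at this
    exact this
  rw [← h2]
  exact hL.mul_mem hS q hf

theorem IsMinimalLeftIdealIn.mul_mem_iff [Countable S] [IsLeftCancelMul S]
    (hweak : IsWeakPSet {x : freeUltrafilters S | (x : Ultrafilter S) ∈ L})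
    (p : Ultrafilter S) {q : Ultrafilter S} (hq : q ∈ freeUltrafilters S) :
    p * q ∈ L ↔ q ∈ L := by
  refine ⟨fun h => ?_, hL.mul_mem hS p⟩
  by_contra hqL
  let d : S → freeUltrafilters S := fun s => ⟨pure s * q, mul_mem_freeUltrafilters hS _ hq⟩
  have hd : range d ⊆ {x : freeUltrafilters S | (x : Ultrafilter S) ∈ L}ᶜ := by
    rintro _ ⟨s, rfl⟩ hs
    exact hqL (hL.mem_of_pure_mul_mem hS hs)
  let x : freeUltrafilters S := ⟨p * q, mul_mem_freeUltrafilters hS p hq⟩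
  suffices hx : x ∈ closure (range d) from
    (hweak _ hd (countable_range d)).subset ⟨hx, h⟩
  rw [closure_subtype, ← range_comp]
  refine (ultrafilterBasis_is_basis.mem_closure_iff).2 ?_
  rintro _ ⟨A, rfl⟩ (hA : A ∈ p * q)
  obtain ⟨s, hs⟩ := p.nonempty_of_mem (mem_mul_iff.1 hA)
  exact ⟨pure s * q, hs, s, rfl⟩

end

end UltraIdeal

theorem mainTheorem1 (S : Type*) [Semigroup S] [Countable S] [Infinite S]
    (hS : UltraIdeal.WeaklyCancellative S) :
    (∃ L : Set (Ultrafilter S),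
      UltraIdeal.IsMinimalLeftIdealIn (UltraIdeal.freeUltrafilters S) L ∧
      UltraIdeal.IsWeakPSet {x : UltraIdeal.freeUltrafilters S | (x : Ultrafilter S) ∈ L}) ∧
    (IsLeftCancelMul S → ∀ L : Set (Ultrafilter S),
      UltraIdeal.IsMinimalLeftIdealIn (UltraIdeal.freeUltrafilters S) L →
      UltraIdeal.IsWeakPSet {x : UltraIdeal.freeUltrafilters S | (x : Ultrafilter S) ∈ L} →
      (∀ p : Ultrafilter S, ∀ q ∈ UltraIdeal.freeUltrafilters S, p * q ∈ L ↔ q ∈ L) ∧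
      (∃ p ∈ L, IsIdempotentElem p) ∧
      (∀ p ∈ L, IsIdempotentElem p →
        UltraIdeal.IsMaximalIdempotentIn UltraIdeal.LeL (UltraIdeal.freeUltrafilters S) p ∧
        UltraIdeal.IsMaximalIdempotentIn UltraIdeal.LeLR (UltraIdeal.freeUltrafilters S) p ∧
        UltraIdeal.IsMinimalIdempotentIn UltraIdeal.LeL (UltraIdeal.freeUltrafilters S) p ∧
        UltraIdeal.IsMinimalIdempotentIn UltraIdeal.LeR (UltraIdeal.freeUltrafilters S) p ∧
        UltraIdeal.IsMinimalIdempotentIn UltraIdeal.LeLR (UltraIdeal.freeUltrafilters S) p)) := by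
  constructor
  · obtain ⟨F, hne, hcof, hinv, hset⟩ := UltraIdeal.exists_settling_filter hS
    exact ⟨_, UltraIdeal.isMinimalLeftIdealIn_of_maximal hS hcof hinv
      fun F' => UltraIdeal.eq_of_settles hset, UltraIdeal.isWeakPSet_of_settles hinv hset⟩
  · intro hcancel L hL hweak
    have hprime := fun (p : Ultrafilter S) (q) (hq : q ∈ UltraIdeal.freeUltrafilters S) =>
      hL.mul_mem_iff hS hweak p hq
    refine ⟨hprime, hL.exists_isIdempotentElem hS, fun p hp hpi => ?_⟩
    have hpS := hL.1.2.1 hp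
    have hright : ∀ {e x : Ultrafilter S}, e ∈ L → IsIdempotentElem e → x ∈ L → x * e = x :=
      fun he hei hx => hL.mul_eq_self hS he hei hx
    have hup : ∀ q ∈ UltraIdeal.freeUltrafilters S, p * q = p → q ∈ L :=
      fun q hq h => (hprime p q hq).1 (h.symm ▸ hp)
    have hdown : ∀ q : Ultrafilter S, q * p = q → q ∈ L :=
      fun q h => h ▸ hL.mul_mem hS q hp
    refine ⟨⟨hpS, hpi, fun q hq hqi h => ?_⟩, ⟨hpS, hpi, fun q hq hqi h => ?_⟩,
      ⟨hpS, hpi, fun q hq hqi h => ?_⟩, ⟨hpS, hpi, fun q hq hqi h => ?_⟩,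
      ⟨hpS, hpi, fun q hq hqi h => ?_⟩⟩
    · exact hright hp hpi (hup q hq h)
    · have : q = p := (hright hp hpi (hup q hq h.1)).symm.trans h.2
      subst this
      exact ⟨hpi, hpi⟩
    · exact hright (hdown q h) hqi hp
    · have hpq : p * q = q := h
      -- `q * p` is an idempotent of `L`, hence a right identity there: `p = p * (q * p) = q * p`.
      have hmem : q * p ∈ L := hL.mul_mem hS q hp
      have hidem : IsIdempotentElem (q * p) := by
        change q * p * (q * p) = q * p
        rw [mul_assoc, ← mul_assoc p, hpq, ← mul_assoc, hqi.eq]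
      have := hright hmem hidem hp
      rw [← mul_assoc, hpq] at this
      exact this
    · have h1 : p * q = p := hright (hdown q h.1) hqi hp
      have : q = p := (h.2 : p * q = q).symm.trans h1
      subst this
      exact ⟨hpi, hpi⟩
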